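/- Let $\kappa$ be an infinite regular cardinal with the discrete topology, $\beta\kappa$ the space of ultrafilters on $\kappa$ (its Čech–Stone compactification, each $\xi\in\kappa$ being identified with its principal ultrafilter), and $\kappa^*=\beta\kappa\setminus\kappa$. For $A\subseteq\kappa$ let $A^*=\{q\in\kappa^*: A\in q\}$; these sets form the standard base of $\kappa^*$. A function $\hat\varphi:[\kappa^+]^{<\omega}\to[\kappa]^{<\omega}$ is $\kappa$-shrinking if $\hat\varphi(\emptyset)=\emptyset$ and $p\subseteq q$ implies $\hat\varphi(p)\subseteq\hat\varphi(q)$. Given such a $\hat\varphi$, a point $x$ of a space $Y$ is a $\kappa$-shrinking point of $Y$ if for all neighbourhoods $\{U_t: t\in[\kappa]^{<\omega}\}$ of $x$ there are neighbourhoods $\{V_\beta:\beta<\kappa^+\}$ of $x$ with $\bigcap_{\alpha\in p}V_\alpha\subseteq U_{\hat\varphi(p)}$ for each non-empty $p\in[\kappa^+]^{<\omega}$. Let $\hat\varphi$ be a $\kappa$-shrinking function, $X$ a compact Hausdorff space and $f:X\to\beta\kappa$ a continuous open surjection. Then there are non-empty closed sets $U_\beta\subseteq X$ ($\beta<2^\kappa$)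 and filters $\mathcal F_\beta$ on $\kappa$ ($\beta<2^\kappa$) such that, writing $C_\gamma=\bigcap_{\beta<\gamma}U_\beta$ (so $C_0=X$), and $B_\gamma=C_\gamma\cap f^{-1}(\kappa^*)$ if this set is non-empty, $B_\gamma=C_\gamma$ otherwise, the following hold. (i) $U_\beta\subseteq U_{\beta'}$ whenever $\beta'\le\beta<2^\kappa$. (ii) For each $\gamma<2^\kappa$, if $f^{-1}(\kappa^*)\cap B_\gamma=\emptyset$, then $U_\gamma=f^{-1}(\{\xi\})\cap B_\gamma$ for some $\xi\in\kappa$. (iii) $\mathcal F_0=\{A\subseteq\kappa:|\kappa\setminus A|<\kappa\}$, the union $\mathcal F=\bigcup_{\beta<2^\kappa}\mathcal F_\beta$ is an ultrafilter, and: (a) $\mathcal F_\beta\subseteq\mathcal F_{\beta'}$ whenever $\beta\le\beta'<2^\kappa$; (b) for each $\beta<2^\kappa$ and each system $(V^r: r\in[\kappa]^{<\omega})$ of members of $\mathcal F_\beta$ with $V^s\subseteq V^r$ whenever $r\subseteq s$, there are $W^\eta\in\mathcal F_{\beta+1}$ ($\eta<\kappa^+$) such that $\left|\bigcap_{\nu\in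 p}W^\nu\setminus V^{\hat\varphi(p)}\right|<\kappa$ for each non-empty $p\in[\kappa^+]^{<\omega}$; (c) for each $\gamma<2^\kappa$ with $f^{-1}(\kappa^*)\cap B_\gamma\ne\emptyset$, and each $A$ in the filter generated by $\bigcup_{\beta<\gamma}\mathcal F_\beta$, $f^{-1}(A^*)\cap B_\gamma\neq\emptyset$. (iv) For each $x\in\bigcap_{\beta<2^\kappa}U_\beta$, either $f(x)\in\kappa$ or $f(x)$ is a $\kappa$-shrinking point of $\kappa^*$. Moreover, if $\mathcal F$ is itself a $\kappa$-shrinking point of $\kappa^*$, then $f(x)=\mathcal F$ for every $x\in\bigcap_{\beta<2^\kappa}U_\beta$. -/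

import Mathlib

open Set Topology
open scoped Cardinal Ordinal

universe u v

/-- The remainder `κ* = βκ \ κ`, where `βκ = Ultrafilter K` is the Stone–Čech compactification of
the discrete space `K` of cardinality `κ`, and `ξ ∈ κ` is identified with the principal ultrafilter
`pure ξ`. -/
def remainder (K : Type u) : Set (Ultrafilter K) :=
  {q | ∀ ξ : K, q ≠ pure ξ}

/-- The standard base of `κ*`: `A* = {q ∈ κ* : A ∈ q}`, for `A ⊆ κ`. -/
def basicClopen {K : Type u} (A : Set K) : Set (Ultrafilter K) :=
  {q | q ∈ remainder K ∧ A ∈ q}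

/-- `κ`-shrinking functions `[κ⁺]^{<ω} → [κ]^{<ω}`, where `#K = κ` and `#L = κ⁺`. -/
structure IsShrinkingFunction {K L : Type u} (φ : Finset L → Finset K) : Prop where
  mono : ∀ p q : Finset L, p ⊆ q → φ p ⊆ φ q
  map_empty : φ ∅ = ∅

/-- `x` is a `κ`-shrinking point of the space `Y`, with respect to `φ`. -/
def IsShrinkingPoint {K L : Type u} (φ : Finset L → Finset K)
    {Y : Type v} [TopologicalSpace Y] (x : Y) : Prop :=
  ∀ U : Finset K → Set Y, (∀ t, U t ∈ 𝓝 x) →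
    ∃ V : L → Set Y, (∀ β, V β ∈ 𝓝 x) ∧
      ∀ p : Finset L, p.Nonempty → (⋂ α ∈ p, V α) ⊆ U (φ p)

/-- The ordinal `2 ^ κ`, where `κ = #K`. -/
noncomputable def twoPow (K : Type u) : Ordinal.{u} :=
  ((2 : Cardinal.{u}) ^ #K).ord

/-- `(F_β : β < 2 ^ κ)` is an increasing chain of filters on `κ` that starts with the filter
`{A ⊆ κ : |κ \ A| < κ}`, its union is the ultrafilter `q`, and every decreasing system
`(V r : r ∈ [κ]^{<ω})` of members of `F_β` is shrunk by a system `(W η : η < κ⁺)` of members of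
`F_{β+1}`. Values of `F` at ordinals `≥ 2 ^ κ` are irrelevant. -/
structure IsShrinkingTower {K L : Type u} (hK : (#K).IsRegular) (φ : Finset L → Finset K)
    (F : Ordinal.{u} → Filter K) (q : Ultrafilter K) : Prop where
  zero : F 0 = Filter.cocardinal K hK
  mono : ∀ β β' : Ordinal.{u}, β ≤ β' → β' < twoPow K → ∀ A : Set K, A ∈ F β → A ∈ F β'
  union : ∀ A : Set K, A ∈ q ↔ ∃ β < twoPow K, A ∈ F β
  shrink : ∀ β < twoPow K, ∀ V : Finset K → Set K,
    (∀ r s : Finset K, r ⊆ s → V s ⊆ V r) → (∀ r, V r ∈ F β) →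
      ∃ W : L → Set K, (∀ η, W η ∈ F (β + 1)) ∧
        ∀ p : Finset L, p.Nonempty → #(((⋂ ν ∈ p, W ν) \ V (φ p) : Set K)) < #K

/-- `C_γ = ⋂ {U_β : β < γ}`; thus `C_0 = X`. -/
def interBelow {X : Type v} (U : Ordinal.{u} → Set X) (γ : Ordinal.{u}) : Set X :=
  {x | ∀ β < γ, x ∈ U β}

open Classical in
/-- `B_γ = C_γ ∩ f⁻¹(κ*)` if this set is non-empty, and `B_γ = C_γ` otherwise. -/
noncomputable def stageSet {K : Type u} {X : Type v} (f : X → Ultrafilter K)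
    (U : Ordinal.{u} → Set X) (γ : Ordinal.{u}) : Set X :=
  if (interBelow U γ ∩ f ⁻¹' remainder K).Nonempty then interBelow U γ ∩ f ⁻¹' remainder K
  else interBelow U γ

/-! The tower may jump at once: `F 0` is the filter of co-small sets and every later `F β` is a
single uniform ultrafilter `q`, provided that `q` shrinks, modulo small sets, each of its own
decreasing systems (`exists_ultrafilter_isShrunkBy`). If `q` is a shrinking point of `κ*`, every `U
β` is the fibre over `q`. Otherwise every `U β` is the fibre over one point of `κ`: all stages `γ >
0` then miss `κ*`, and stage `0` imposes nothing.

The ultrafilter comes from a Kunen-style recursion over the `2 ^ κ` systems, along an independent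
matrix with `2 ^ κ` indices and a set for each `η : L` at each index (`IsShrinkingMatrix`). A step
either expels some `V r` by adding a cylinder, or spends a fresh index to shrink `V`
(`IsIndependentMod.exists_step`).

The matrix lives on levels `x : K` with finite data, fewer than `κ` points per level. Since `L` may
have size `κ⁺`, its elements cannot be named below `x`; `exists_typing` gives them types that
separate any finite set from its relevant predecessors at arbitrarily high levels. Types are heights
in tree orders on `L` that increase to the full order and have fewer than `κ` predecessors
everywhere. -/

/-- A well-order whose order type is a regular cardinal. -/
structure IsRegularWellOrder (K : Type u) [LinearOrder K] : Prop where
  regular : (#K).IsRegular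
  small : ∀ x : K, #(Iio x) < #K

/-! ### Regularity: fewer than `κ` eventual conditions hold together -/

section Small

variable {K : Type u} [LinearOrder K]

theorem IsRegularWellOrder.small_Iic (hK : IsRegularWellOrder K) (x : K) : #(Iic x) < #K := by
  rw [← Iio_insert]
  exact (Cardinal.mk_insert_le).trans_lt
    (Cardinal.add_lt_of_lt hK.regular.aleph0_le (hK.small x)
      (Cardinal.one_lt_aleph0.trans_le hK.regular.aleph0_le))

theorem IsRegularWellOrder.exists_forall_lt (hK : IsRegularWellOrder K) {ι : Type u}
    (hι : #ι < #K) (f : ι → K) : ∃ x, ∀ i, f i < x := by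
  by_contra! h
  have h1 : #(⋃ i, Iic (f i)) < #K :=
    (Cardinal.card_iUnion_lt_iff_forall_of_isRegular hK.regular hι).2
      fun i => hK.small_Iic (f i)
  have h2 : (⋃ i, Iic (f i)) = univ := by
    ext x
    obtain ⟨i, hi⟩ := h x
    simpa using ⟨i, hi⟩
  rw [h2, Cardinal.mk_univ] at h1
  exact lt_irrefl _ h1

theorem IsRegularWellOrder.exists_gt (hK : IsRegularWellOrder K) (a : K) : ∃ x, a < x := by
  obtain ⟨x, hx⟩ := hK.exists_forall_lt (ι := PUnit)
    (by simpa using hK.regular.nat_lt 1) (fun _ => a)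
  exact ⟨x, hx ⟨⟩⟩

theorem IsRegularWellOrder.nonempty (hK : IsRegularWellOrder K) : Nonempty K := by
  rw [← Cardinal.mk_ne_zero_iff]
  exact hK.regular.ne_zero

/-- Fewer than `#K` many statements, each of which holds eventually, hold simultaneously from some
point on. -/
theorem IsRegularWellOrder.exists_forall_of_small (hK : IsRegularWellOrder K) {ι : Type u}
    (hι : #ι < #K) {p : ι → K → Prop} (h : ∀ i, ∃ x, ∀ y, x ≤ y → p i y) :
    ∃ x, ∀ y, x ≤ y → ∀ i, p i y := by
  choose f hf using h
  obtain ⟨x, hx⟩ := hK.exists_forall_lt hι f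
  exact ⟨x, fun y hy i => hf i y ((hx i).le.trans hy)⟩

theorem IsRegularWellOrder.small_finite (hK : IsRegularWellOrder K) {ι : Type u} [Finite ι] :
    #ι < #K :=
  (Cardinal.lt_aleph0_of_finite ι).trans_le hK.regular.aleph0_le

theorem IsRegularWellOrder.small_prod (hK : IsRegularWellOrder K) {α β : Type u}
    (hα : #α < #K) (hβ : #β < #K) : #(α × β) < #K := by
  rw [Cardinal.mk_prod, Cardinal.lift_id, Cardinal.lift_id]
  exact Cardinal.mul_lt_of_lt hK.regular.aleph0_le hα hβ

theorem IsRegularWellOrder.small_finset (hK : IsRegularWellOrder K) {α : Type u}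
    (hα : #α < #K) : #(Finset α) < #K := by
  cases finite_or_infinite α
  · exact hK.small_finite
  · rwa [Cardinal.mk_finset_of_infinite]

theorem IsRegularWellOrder.exists_forall_mem_finset (hK : IsRegularWellOrder K) {α : Type*}
    (s : Finset α) {p : α → K → Prop} (h : ∀ a ∈ s, ∃ x, ∀ y, x ≤ y → p a y) :
    ∃ x, ∀ y, x ≤ y → ∀ a ∈ s, p a y := by
  classical
  induction s using Finset.induction_on with
  | empty => exact ⟨hK.nonempty.some, by simp⟩
  | insert a s ha ih =>
    obtain ⟨x, hx⟩ := h a (by simp)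
    obtain ⟨x', hx'⟩ := ih fun b hb => h b (by simp [hb])
    refine ⟨max x x', fun y hy b hb => ?_⟩
    rcases Finset.mem_insert.1 hb with rfl | hb
    · exact hx y ((le_max_left _ _).trans hy)
    · exact hx' y ((le_max_right _ _).trans hy) b hb

end Small

/-! ### Tree orders approximating a well-order -/

section Tree

variable {K L : Type u} [LinearOrder K] [LinearOrder L]

/-- The set of predecessors of `η` in the `x`-th tree order on `L`. It is the downward closure of
the longest admissible initial piece of `Iio η` with respect to the enumeration `idx η`. -/
def treePred [WellFoundedLT L] (idx : L → L → K) (η : L) (x : K) : Set L :=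
  {γ | ∃ β, ∃ _ : β < η, idx η β < x ∧
    (∀ β', ∀ _ : β' < η, idx η β' ≤ idx η β →
      (∀ β'', idx η β'' ≤ idx η β → β'' < β' → β'' ∈ treePred idx β' x) ∧
      -- This clause keeps chains short when `κ = ω`; asking it for all `y ≥ x` makes the orders
      -- increase with `x`.
      ∀ y, x ≤ y → #K = ℵ₀ →
        #(treePred idx β' y) + #(Iio (idx η β)) + 1 ≤ #(Iio y)) ∧
    (γ = β ∨ γ ∈ treePred idx β x)}
termination_by wellFounded_lt.wrap η
decreasing_by all_goals (simp only [WellFounded.wrap]; assumption)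

variable [WellFoundedLT L]

/-- The initial piece of `Iio η` up to `β` generates the `x`-th tree order below `η`. -/
def IsAdmissible (idx : L → L → K) (η : L) (x : K) (β : L) : Prop :=
  β < η ∧ idx η β < x ∧ ∀ β' < η, idx η β' ≤ idx η β →
    (∀ β'', idx η β'' ≤ idx η β → β'' < β' → β'' ∈ treePred idx β' x) ∧
    ∀ y, x ≤ y → #K = ℵ₀ →
      #(treePred idx β' y) + #(Iio (idx η β)) + 1 ≤ #(Iio y)

variable {idx : L → L → K}

theorem mem_treePred {η : L} {x : K} {γ : L} :
    γ ∈ treePred idx η x ↔ ∃ β, IsAdmissible idx η x β ∧ (γ = β ∨ γ ∈ treePred idx β x) := by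
  rw [treePred]
  simp only [mem_ofPred_eq, IsAdmissible]
  constructor
  · rintro ⟨β, h1, h2, h3, h4⟩
    exact ⟨β, ⟨h1, h2, h3⟩, h4⟩
  · rintro ⟨β, ⟨h1, h2, h3⟩, h4⟩
    exact ⟨β, h1, h2, h3, h4⟩

theorem lt_of_mem_treePred {η : L} {x : K} : ∀ {γ : L}, γ ∈ treePred idx η x → γ < η := by
  induction η using WellFoundedLT.induction with
  | ind η ih =>
    intro γ h
    obtain ⟨β, hβ, rfl | h⟩ := mem_treePred.1 h
    · exact hβ.1
    · exact (ih β hβ.1 h).trans hβ.1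

theorem treePred_mono {η : L} {x y : K} (hxy : x ≤ y) : treePred idx η x ⊆ treePred idx η y := by
  induction η using WellFoundedLT.induction with
  | ind η ih =>
    intro γ h
    obtain ⟨β, ⟨h1, h2, h3⟩, h⟩ := mem_treePred.1 h
    refine mem_treePred.2 ⟨β, ⟨h1, h2.trans_le hxy, fun β' hβ' hle => ⟨fun β'' h' h'' => ?_,
      fun z hz => (h3 β' hβ' hle).2 z (hxy.trans hz)⟩⟩, h.imp_right fun h => ih β h1 h⟩
    exact ih β' hβ' ((h3 β' hβ' hle).1 β'' h' h'')

/-- Whichever of `β`, `γ` has the larger index, its admissibility applies to `γ` and puts `β` below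
it. -/
theorem IsAdmissible.mem_pred {η : L} {x : K} {β γ : L} (hβ : IsAdmissible idx η x β)
    (hγ : IsAdmissible idx η x γ) (h : β < γ) : β ∈ treePred idx γ x := by
  rcases le_total (idx η β) (idx η γ) with h' | h'
  · exact (hγ.2.2 γ hγ.1 le_rfl).1 β h' h
  · exact (hβ.2.2 γ hγ.1 h').1 β le_rfl h

theorem treePred_trans {η : L} {x : K} : ∀ {β γ : L}, γ ∈ treePred idx β x →
    β ∈ treePred idx η x → γ ∈ treePred idx η x := by
  induction η using WellFoundedLT.induction with
  | ind η ih =>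
    intro β γ h1 h2
    obtain ⟨β', hβ', rfl | h2⟩ := mem_treePred.1 h2
    · exact mem_treePred.2 ⟨_, hβ', .inr h1⟩
    · exact mem_treePred.2 ⟨_, hβ', .inr (ih β' hβ'.1 h1 h2)⟩

theorem exists_common_admissible {η : L} {x : K} {β γ : L} (h1 : β ∈ treePred idx η x)
    (h2 : γ ∈ treePred idx η x) : ∃ m, IsAdmissible idx η x m ∧
      (β = m ∨ β ∈ treePred idx m x) ∧ (γ = m ∨ γ ∈ treePred idx m x) := by
  obtain ⟨m, hm, h1⟩ := mem_treePred.1 h1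
  obtain ⟨n, hn, h2⟩ := mem_treePred.1 h2
  rcases lt_trichotomy m n with h | rfl | h
  · refine ⟨n, hn, .inr ?_, h2⟩
    rcases h1 with rfl | h1
    · exact hm.mem_pred hn h
    · exact treePred_trans h1 (hm.mem_pred hn h)
  · exact ⟨m, hm, h1, h2⟩
  · refine ⟨m, hm, h1, .inr ?_⟩
    rcases h2 with rfl | h2
    · exact hn.mem_pred hm h
    · exact treePred_trans h2 (hn.mem_pred hm h)

theorem treePred_linear {η : L} {x : K} : ∀ {β γ : L}, β ∈ treePred idx η x →
    γ ∈ treePred idx η x → β < γ → β ∈ treePred idx γ x := by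
  induction η using WellFoundedLT.induction with
  | ind η ih =>
    intro β γ h1 h2 hlt
    obtain ⟨m, hm, h1, h2⟩ := exists_common_admissible h1 h2
    rcases h2 with rfl | h2
    · exact h1.resolve_left hlt.ne
    · rcases h1 with rfl | h1
      · exact absurd (lt_of_mem_treePred h2) hlt.not_gt
      · exact ih m hm.1 h1 h2 hlt

omit [WellFoundedLT L] in
theorem mk_idx_le (hK : IsRegularWellOrder K) (hidx : ∀ η, InjOn (idx η) (Iio η)) (η : L)
    (k : K) : #{β | β < η ∧ idx η β ≤ k} < #K := by
  refine lt_of_le_of_lt ?_ (hK.small_Iic k)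
  rw [← Cardinal.mk_image_eq_of_injOn (idx η) _ ((hidx η).mono fun β h => h.1)]
  refine Cardinal.mk_le_mk_of_subset ?_
  rintro _ ⟨β, h, rfl⟩
  exact h.2

theorem mk_treePred_lt (hK : IsRegularWellOrder K) (hidx : ∀ η, InjOn (idx η) (Iio η)) (η : L)
    (x : K) : #(treePred idx η x) < #K := by
  induction η using WellFoundedLT.induction with
  | ind η ih =>
    have : treePred idx η x ⊆
        ⋃ β : {β | β < η ∧ idx η β ≤ x}, insert β.1 (treePred idx β.1 x) := by
      intro γ h
      obtain ⟨β, hβ, h⟩ := mem_treePred.1 h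
      exact mem_iUnion.2 ⟨⟨β, hβ.1, hβ.2.1.le⟩, h⟩
    refine (Cardinal.mk_le_mk_of_subset this).trans_lt
      ((Cardinal.card_iUnion_lt_iff_forall_of_isRegular hK.regular (mk_idx_le hK hidx η x)).2 ?_)
    rintro ⟨β, hβ⟩
    exact Cardinal.mk_insert_le.trans_lt (Cardinal.add_lt_of_lt hK.regular.aleph0_le (ih β hβ.1)
      (by simpa using hK.regular.nat_lt 1))

/-- Admissible elements form a chain, so the greatest of finitely many carries all predecessors of
`η`. -/
theorem treePred_subset_insert {η : L} {x : K}
    (hfin : {β | IsAdmissible idx η x β}.Finite)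
    (hne : ∃ β, IsAdmissible idx η x β) : ∃ β, IsAdmissible idx η x β ∧
      treePred idx η x ⊆ insert β (treePred idx β x) := by
  obtain ⟨m, hm, hmax⟩ := hfin.exists_maximal hne
  refine ⟨m, hm, fun γ h => ?_⟩
  obtain ⟨β, hβ, h⟩ := mem_treePred.1 h
  rcases lt_trichotomy β m with hlt | rfl | hlt
  · right
    rcases h with rfl | h
    · exact hβ.mem_pred hm hlt
    · exact treePred_trans h (hβ.mem_pred hm hlt)
  · exact h
  · exact absurd (hmax hβ hlt.le) hlt.not_ge

end Tree

/-! ### Exhaustion of the order, and chain sizes when `κ = ω` -/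

section TreeGrowth

variable {K L : Type u} [LinearOrder K] [LinearOrder L] [WellFoundedLT L] {idx : L → L → K}

theorem IsRegularWellOrder.exists_le_mk_Iio {K : Type u} [LinearOrder K]
    (hK : IsRegularWellOrder K) (n : ℕ) : ∃ k : K, (n : Cardinal) ≤ #(Iio k) := by
  have : Infinite K := Cardinal.infinite_iff.2 hK.regular.aleph0_le
  obtain ⟨s, hs⟩ := Infinite.exists_subset_card_eq K n
  obtain ⟨k, hk⟩ := hK.exists_forall_lt (ι := s) hK.small_finite Subtype.val
  refine ⟨k, ?_⟩
  have h1 : (s : Set K) ⊆ Iio k := fun a ha => hk ⟨a, ha⟩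
  have h2 := Cardinal.mk_le_mk_of_subset h1
  simpa [hs] using h2

theorem mk_treePred_le_succ (hK : IsRegularWellOrder K) (hidx : ∀ η, InjOn (idx η) (Iio η))
    (hω : #K = ℵ₀) {η : L} {x : K} (hne : ∃ β, IsAdmissible idx η x β) :
    ∃ β, IsAdmissible idx η x β ∧ #(treePred idx η x) ≤ #(treePred idx β x) + 1 := by
  obtain ⟨β, hβ, h⟩ := treePred_subset_insert (idx := idx) (η := η) (x := x) (by
    have h1 := mk_idx_le hK hidx η x
    rw [hω, Cardinal.lt_aleph0_iff_set_finite] at h1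
    exact h1.subset fun β hβ => ⟨hβ.1, hβ.2.1.le⟩) hne
  exact ⟨β, hβ, (Cardinal.mk_le_mk_of_subset h).trans Cardinal.mk_insert_le⟩

theorem treePred_eq_empty {η : L} {x : K} (h : ¬ ∃ β, IsAdmissible idx η x β) :
    treePred idx η x = ∅ := by
  ext γ
  simp only [mem_empty_iff_false, iff_false]
  intro hγ
  obtain ⟨β, hβ, -⟩ := mem_treePred.1 hγ
  exact h ⟨β, hβ⟩

theorem mk_treePred_le (hK : IsRegularWellOrder K) (hidx : ∀ η, InjOn (idx η) (Iio η))
    (hω : #K = ℵ₀) (η : L) (x : K) : #(treePred idx η x) ≤ #(Iio x) := by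
  by_cases h : ∃ β, IsAdmissible idx η x β
  · obtain ⟨β, hβ, h⟩ := mk_treePred_le_succ hK hidx hω h
    refine h.trans (le_trans ?_ ((hβ.2.2 β hβ.1 le_rfl).2 x le_rfl hω))
    gcongr
    exact le_self_add
  · simp [treePred_eq_empty h]

/-- Admissibility of `β` involves only the fewer than `κ` elements with index up to that of `β`;
each condition on them holds eventually, hence all do at once. -/
theorem exists_forall_isAdmissible (hK : IsRegularWellOrder K)
    (hidx : ∀ η, InjOn (idx η) (Iio η)) {η : L}
    (h1 : ∀ β < η, ∀ γ < β, ∃ x, ∀ y, x ≤ y → γ ∈ treePred idx β y)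
    (h2 : ∀ β < η, #K = ℵ₀ → ∀ n : ℕ, ∃ x, ∀ y, x ≤ y →
      #(treePred idx β y) + n ≤ #(Iio y)) {β : L} (hβ : β < η) :
    ∃ x, ∀ y, x ≤ y → IsAdmissible idx η y β := by
  have hS := mk_idx_le hK hidx η (idx η β)
  set S := {β' | β' < η ∧ idx η β' ≤ idx η β} with hSdef
  obtain ⟨x₁, hx₁⟩ := hK.exists_forall_of_small (hK.small_prod hS hS)
    (p := fun q y => q.1.1 < q.2.1 → q.1.1 ∈ treePred idx q.2.1 y) (by
      rintro ⟨⟨a, ha⟩, ⟨b, hb⟩⟩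
      by_cases hab : a < b
      · obtain ⟨x, hx⟩ := h1 b hb.1 a hab
        exact ⟨x, fun y hy _ => hx y hy⟩
      · exact ⟨hK.nonempty.some, fun y _ h => absurd h hab⟩)
  obtain ⟨x₂, hx₂⟩ := hK.exists_forall_of_small hS
    (p := fun b y => #K = ℵ₀ →
      #(treePred idx b.1 y) + #(Iio (idx η β)) + 1 ≤ #(Iio y)) (by
      rintro ⟨b, hb⟩
      by_cases hω : #K = ℵ₀
      · have h3 := hK.small (idx η β)
        rw [hω] at h3
        obtain ⟨m, hm⟩ := Cardinal.lt_aleph0.1 h3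
        obtain ⟨x, hx⟩ := h2 b hb.1 hω (m + 1)
        refine ⟨x, fun y hy _ => ?_⟩
        have := hx y hy
        rw [hm]
        push_cast at this
        rwa [← add_assoc] at this
      · exact ⟨hK.nonempty.some, fun y _ h => absurd h hω⟩)
  obtain ⟨x₃, hx₃⟩ := hK.exists_gt (idx η β)
  refine ⟨max x₃ (max x₁ x₂), fun y hy => ?_⟩
  simp only [max_le_iff] at hy
  refine ⟨hβ, hx₃.trans_le hy.1, fun β' hβ' hle => ⟨fun β'' hle' hlt => ?_, fun z hz => ?_⟩⟩
  · exact hx₁ y hy.2.1 ⟨⟨β'', hlt.trans hβ', hle'⟩, ⟨β', hβ', hle⟩⟩ hlt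
  · exact hx₂ z (hy.2.2.trans hz) ⟨β', hβ', hle⟩

/-- The two claims need a joint induction, as admissibility rests on both. The term `#(Iio (idx η
β))` in its definition is what makes the surplus unbounded. -/
theorem treePred_growth (hK : IsRegularWellOrder K) (hidx : ∀ η, InjOn (idx η) (Iio η)) (η : L) :
    (∀ β < η, ∃ x, ∀ y, x ≤ y → β ∈ treePred idx η y) ∧
    (#K = ℵ₀ → ∀ n : ℕ, ∃ x, ∀ y, x ≤ y → #(treePred idx η y) + n ≤ #(Iio y)) := by
  induction η using WellFoundedLT.induction with
  | ind η ih =>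
    have adm := fun β hβ => exists_forall_isAdmissible hK hidx (η := η) (β := β)
      (fun β hβ => (ih β hβ).1) (fun β hβ => (ih β hβ).2) hβ
    refine ⟨fun β hβ => ?_, fun hω n => ?_⟩
    · obtain ⟨x, hx⟩ := adm β hβ
      exact ⟨x, fun y hy => mem_treePred.2 ⟨β, hx y hy, .inl rfl⟩⟩
    · by_cases hbig : ∃ β < η, (n : Cardinal) ≤ #(Iio (idx η β))
      · obtain ⟨β, hβ, hn⟩ := hbig
        obtain ⟨x, hx⟩ := adm β hβ
        refine ⟨x, fun y hy => ?_⟩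
        obtain ⟨m, hm, hle⟩ := mk_treePred_le_succ hK hidx hω ⟨β, hx y hy⟩
        obtain ⟨k, hnk, hk⟩ : ∃ k : K, (n : Cardinal) ≤ #(Iio k) ∧
            #(treePred idx m y) + #(Iio k) + 1 ≤ #(Iio y) := by
          -- The greatest admissible `m` gets its surplus from whichever of `β`, `m` has the larger
          -- index.
          rcases le_total (idx η β) (idx η m) with h | h
          · exact ⟨_, hn.trans (Cardinal.mk_le_mk_of_subset (Iio_subset_Iio h)),
              (hm.2.2 m hm.1 le_rfl).2 y le_rfl hω⟩
          · exact ⟨_, hn, ((hx y hy).2.2 m hm.1 h).2 y le_rfl hω⟩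
        calc #(treePred idx η y) + n ≤ (#(treePred idx m y) + 1) + #(Iio k) := by gcongr
          _ = #(treePred idx m y) + #(Iio k) + 1 := by ring
          _ ≤ _ := hk
      -- Now all indices lie below a fixed `k`, so `η` has fewer than `κ` predecessors and their
      -- bounds hold uniformly; `n + 1` pays for inserting `m`.
      · push Not at hbig
        obtain ⟨k, hk⟩ := hK.exists_le_mk_Iio n
        have hsmall : #(Iio η) < #K := by
          refine lt_of_le_of_lt (Cardinal.mk_le_mk_of_subset ?_) (mk_idx_le hK hidx η k)
          intro β hβ
          refine ⟨hβ, le_of_not_ge fun h => ?_⟩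
          exact (hk.trans (Cardinal.mk_le_mk_of_subset (Iio_subset_Iio h))).not_gt (hbig β hβ)
        obtain ⟨x, hx⟩ := hK.exists_forall_of_small hsmall
          (p := fun β y => #(treePred idx β.1 y) + (n + 1 : ℕ) ≤ #(Iio y))
          (fun β => (ih β.1 β.2).2 hω (n + 1))
        refine ⟨max x k, fun y hy => ?_⟩
        rw [max_le_iff] at hy
        by_cases hne : ∃ β, IsAdmissible idx η y β
        · obtain ⟨m, hm, hle⟩ := mk_treePred_le_succ hK hidx hω hne
          calc #(treePred idx η y) + n ≤ (#(treePred idx m y) + 1) + n := by gcongr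
            _ = #(treePred idx m y) + (n + 1 : ℕ) := by push_cast; ring
            _ ≤ _ := hx y hy.1 ⟨m, hm.1⟩
        · rw [treePred_eq_empty hne]
          simpa using hk.trans (Cardinal.mk_le_mk_of_subset (Iio_subset_Iio hy.2))

end TreeGrowth

/-! ### Tree systems -/

/-- A continuous increasing system, indexed by `K`, of tree orders on `L` that exhausts the order
of `L`; `Q η d` is the set of predecessors of `η` in the `d`-th order. -/
structure IsTreeSystem {K L : Type u} [LinearOrder K] [LinearOrder L] (Q : L → K → Set L) :
    Prop where
  lt : ∀ {η d β}, β ∈ Q η d → β < η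
  mono : ∀ {η d d'}, d ≤ d' → Q η d ⊆ Q η d'
  trans : ∀ {η d β γ}, γ ∈ Q β d → β ∈ Q η d → γ ∈ Q η d
  linear : ∀ {η d β γ}, β ∈ Q η d → γ ∈ Q η d → β < γ → β ∈ Q γ d
  continuous : ∀ {η d β}, β ∈ Q η d → ∃ x < d, ∀ d', x < d' → β ∈ Q η d'
  small : ∀ η d, #(Q η d) < #K
  eventually : ∀ {η β}, β < η → ∃ x, ∀ y, x ≤ y → β ∈ Q η y
  mk_le : #K = ℵ₀ → ∀ η d, #(Q η d) ≤ #(Iio d)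

theorem exists_isTreeSystem {K L : Type u} [LinearOrder K] [LinearOrder L]
    [WellFoundedLT L] (hK : IsRegularWellOrder K) (hL : ∀ η : L, #(Iio η) ≤ #K) :
    ∃ Q : L → K → Set L, IsTreeSystem Q := by
  have hidx : ∀ η : L, ∃ f : L → K, InjOn f (Iio η) := by
    intro η
    obtain ⟨e⟩ := hL η
    have := hK.nonempty
    refine ⟨fun β => if h : β < η then e ⟨β, h⟩ else this.some, fun β hβ γ hγ h => ?_⟩
    rw [mem_Iio] at hβ hγ
    simp only [hβ, hγ, dite_true] at h
    exact congrArg Subtype.val (e.injective h)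
  choose idx hidx using hidx
  -- Taking the union over `x < d` makes the system continuous at limits.
  refine ⟨fun η d => {β | ∃ x < d, β ∈ treePred idx η x}, ?_, ?_, ?_, ?_, ?_, ?_, ?_, ?_⟩
  · rintro η d β ⟨x, -, h⟩
    exact lt_of_mem_treePred h
  · rintro η d d' hd β ⟨x, hx, h⟩
    exact ⟨x, hx.trans_le hd, h⟩
  · rintro η d β γ ⟨x, hx, h⟩ ⟨y, hy, h'⟩
    exact ⟨max x y, max_lt hx hy, treePred_trans (treePred_mono (le_max_left _ _) h)
      (treePred_mono (le_max_right _ _) h')⟩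
  · rintro η d β γ ⟨x, hx, h⟩ ⟨y, hy, h'⟩ hlt
    exact ⟨max x y, max_lt hx hy, treePred_linear (treePred_mono (le_max_left _ _) h)
      (treePred_mono (le_max_right _ _) h') hlt⟩
  · rintro η d β ⟨x, hx, h⟩
    exact ⟨x, hx, fun d' hd' => ⟨x, hd', h⟩⟩
  · intro η d
    have : {β | ∃ x < d, β ∈ treePred idx η x} = ⋃ x : Iio d, treePred idx η x.1 := by
      ext; simp
    rw [this]
    exact (Cardinal.card_iUnion_lt_iff_forall_of_isRegular hK.regular (hK.small d)).2
      fun x => mk_treePred_lt hK hidx η x.1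
  · intro η β hβ
    obtain ⟨x, hx⟩ := (treePred_growth hK hidx η).1 β hβ
    obtain ⟨x', hx'⟩ := hK.exists_gt x
    exact ⟨x', fun y hy => ⟨x, hx'.trans_le hy, hx x le_rfl⟩⟩
  · intro hω η d
    have hfin : (Iio d).Finite := by
      rw [← Cardinal.lt_aleph0_iff_set_finite, ← hω]
      exact hK.small d
    rcases (Iio d).eq_empty_or_nonempty with h | h
    · have : {β | ∃ x < d, β ∈ treePred idx η x} = ∅ := by
        ext β
        simp only [mem_ofPred_eq, mem_empty_iff_false, iff_false]
        rintro ⟨x, hx, -⟩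
        exact (h ▸ hx : x ∈ (∅ : Set K))
      simp [this]
    · obtain ⟨m, hm, hmax⟩ := hfin.exists_maximal h
      have : {β | ∃ x < d, β ∈ treePred idx η x} ⊆ treePred idx η m := by
        rintro β ⟨x, hx, h⟩
        exact treePred_mono ((le_total x m).elim id fun h => hmax hx h) h
      exact (Cardinal.mk_le_mk_of_subset this).trans ((mk_treePred_le hK hidx hω η m).trans
        (Cardinal.mk_le_mk_of_subset (Iio_subset_Iio (le_of_lt hm))))

/-- Construction by well-founded recursion of a function that satisfies a given relation with its
own restrictions to initial segments. -/
theorem exists_forall_of_wellFounded {L : Type*} {α : Type*} [LT L] [WellFoundedLT L]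
    {R : (η : L) → ((β : L) → β < η → α) → α → Prop} (h : ∀ η g, ∃ k, R η g k) :
    ∃ f : L → α, ∀ η, R η (fun β _ => f β) (f η) := by
  choose F hF using h
  refine ⟨(wellFounded_lt (α := L)).fix F, fun η => ?_⟩
  conv in (wellFounded_lt (α := L)).fix F η => rw [WellFounded.fix_eq]
  exact hF _ _

/-! ### Heights, closed levels and types -/

section Typing

variable {K L : Type u} [LinearOrder K] [LinearOrder L]

/-- Greedy colouring: each `η` gets the least height not used by its fewer than `κ` predecessors. -/
theorem IsTreeSystem.exists_height [WellFoundedLT K] [WellFoundedLT L] {Q : L → K → Set L}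
    (hK : IsRegularWellOrder K) (hQ : IsTreeSystem Q) :
    ∃ ht : K → L → K, (∀ d η, ∀ β ∈ Q η d, ht d β ≠ ht d η) ∧
      (#K = ℵ₀ → ∀ d η, ht d η ≤ d) := by
  have key : ∀ d : K, ∃ h : L → K, ∀ η, (∀ β, ∀ _ : β < η, β ∈ Q η d → h β ≠ h η) ∧
      (#K = ℵ₀ → h η ≤ d) := by
    intro d
    refine exists_forall_of_wellFounded
      (R := fun η g k => (∀ β, ∀ h : β < η, β ∈ Q η d → g β h ≠ k) ∧ (#K = ℵ₀ → k ≤ d)) ?_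
    intro η g
    set S : Set K := range fun β : Q η d => g β.1 (hQ.lt β.2) with hS
    have hSQ : #S ≤ #(Q η d) := Cardinal.mk_range_le
    have hne : Sᶜ.Nonempty := by
      rw [nonempty_compl]
      intro h
      have := hSQ.trans_lt (hQ.small η d)
      rw [h, Cardinal.mk_univ] at this
      exact lt_irrefl _ this
    refine ⟨wellFounded_lt.min Sᶜ hne, fun β hβ hβQ h => ?_, fun hω => ?_⟩
    · exact wellFounded_lt.min_mem Sᶜ hne ⟨⟨β, hβQ⟩, h⟩
    -- A height above `d` would need all of `Iic d` used up, one value more than the at most `#(Iio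
    -- d)` predecessors can use.
    · by_contra! hlt
      have h1 : Iic d ⊆ S := by
        intro k hk
        by_contra hkS
        exact wellFounded_lt.not_lt_min Sᶜ hkS ((mem_Iic.1 hk).trans_lt hlt)
      have h2 := (Cardinal.mk_le_mk_of_subset h1).trans (hSQ.trans (hQ.mk_le hω η d))
      rw [← Iio_insert, Cardinal.mk_insert (by simp)] at h2
      have h3 := hK.small d
      rw [hω] at h3
      obtain ⟨n, hn⟩ := Cardinal.lt_aleph0.1 h3
      rw [hn] at h2
      norm_cast at h2
      lia
  choose ht h using key
  exact ⟨ht, fun d η β hβ => (h d η).1 β (hQ.lt hβ) hβ, fun hω d η => (h d η).2 hω⟩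

/-- The set of levels `d` such that the heights, in lower levels, of `η` and its predecessors in
level `d` are smaller than `d`. -/
def heightClosed (Q : L → K → Set L) (ht : K → L → K) (η : L) : Set K :=
  {d | ∀ β, (β = η ∨ β ∈ Q η d) → ∀ d' < d, ht d' β < d}

variable {Q : L → K → Set L} {ht : K → L → K}

theorem IsTreeSystem.heightClosed_of_mem (hQ : IsTreeSystem Q) {η β : L} {d : K}
    (hd : d ∈ heightClosed Q ht η) (hβ : β ∈ Q η d) : d ∈ heightClosed Q ht β := by
  rintro γ (rfl | hγ)
  · exact hd γ (.inr hβ)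
  · exact hd γ (.inr (hQ.trans hγ hβ))

/-- `heightClosed` contains the least upper bounds of its subsets without a greatest element. -/
theorem IsTreeSystem.heightClosed_of_forall_lt (hQ : IsTreeSystem Q) {η : L} {u : K}
    (h : ∀ a < u, ∃ e, a < e ∧ e ≤ u ∧ ∀ β, (β = η ∨ β ∈ Q η e) → ∀ d' < e, ht d' β < u) :
    u ∈ heightClosed Q ht η := by
  rintro β hβ d' hd'
  obtain ⟨x, hx, hβ⟩ : ∃ x < u, ∀ e, x < e → (β = η ∨ β ∈ Q η e) := by
    rcases hβ with rfl | hβ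
    · exact ⟨d', hd', fun _ _ => .inl rfl⟩
    · obtain ⟨x, hx, h⟩ := hQ.continuous hβ
      exact ⟨x, hx, fun e he => .inr (h e he)⟩
  obtain ⟨e, he, -, h⟩ := h (max x d') (max_lt hx hd')
  rw [max_lt_iff] at he
  exact h β (hβ e he.1) d' he.2

theorem IsTreeSystem.exists_isGreatest [WellFoundedLT K] (hQ : IsTreeSystem Q) (η : L) (x : K) :
    ∃ d, IsGreatest (heightClosed Q ht η ∩ Iic x) d := by
  set S := heightClosed Q ht η ∩ Iic x with hS
  have hne : (upperBounds S).Nonempty := ⟨x, fun a ha => ha.2⟩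
  set u := wellFounded_lt.min (upperBounds S) hne with hu
  have hub : u ∈ upperBounds S := wellFounded_lt.min_mem _ hne
  have hux : u ≤ x := le_of_not_gt fun h =>
    wellFounded_lt.not_lt_min (upperBounds S) (fun a ha => ha.2 : x ∈ upperBounds S) h
  by_cases huS : u ∈ S
  · exact ⟨u, huS, hub⟩
  · refine ⟨u, ⟨hQ.heightClosed_of_forall_lt fun a ha => ?_, hux⟩, hub⟩
    obtain ⟨e, heS, hae⟩ : ∃ e ∈ S, a < e := by
      by_contra! h
      exact wellFounded_lt.not_lt_min (upperBounds S) (fun e he => h e he : a ∈ upperBounds S) ha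
    exact ⟨e, hae, hub heS, fun β hβ d' hd' => (heS.1 β hβ d' hd').trans_le (hub heS)⟩

/-- For `κ = ω` every level is closed, because heights at level `d'` are at most `d'`. For `κ > ω`,
iterate a bound on the heights `ω` times and take the supremum, using continuity of the trees. -/
theorem IsTreeSystem.exists_heightClosed_gt [WellFoundedLT K] (hK : IsRegularWellOrder K)
    (hQ : IsTreeSystem Q) (hht : #K = ℵ₀ → ∀ d η, ht d η ≤ d) (η : L) (a : K) :
    ∃ d, a < d ∧ d ∈ heightClosed Q ht η := by
  by_cases hω : #K = ℵ₀
  · obtain ⟨d, hd⟩ := hK.exists_gt a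
    exact ⟨d, hd, fun β _ d' hd' => (hht hω d' β).trans_lt hd'⟩
  have hω' : ℵ₀ < #K := lt_of_le_of_ne hK.regular.aleph0_le (Ne.symm hω)
  have step : ∀ b : K, ∃ c, b < c ∧ ∀ β, (β = η ∨ β ∈ Q η b) → ∀ d' < b, ht d' β < c := by
    intro b
    have hs : #(insert η (Q η b) : Set L) < #K :=
      Cardinal.mk_insert_le.trans_lt (Cardinal.add_lt_of_lt hK.regular.aleph0_le (hQ.small η b)
        (by simpa using hK.regular.nat_lt 1))
    obtain ⟨c, hc⟩ := hK.exists_forall_lt (hK.small_prod hs (hK.small b))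
      fun q => ht q.2.1 q.1.1
    obtain ⟨c', hc'⟩ := hK.exists_gt b
    exact ⟨max c c', hc'.trans_le (le_max_right _ _), fun β hβ d' hd' =>
      (hc ⟨⟨β, hβ⟩, ⟨d', hd'⟩⟩).trans_le (le_max_left _ _)⟩
  choose g hg hg' using step
  let s : ℕ → K := fun n => g^[n] a
  have hs : ∀ n, s (n + 1) = g (s n) := fun n => Function.iterate_succ_apply' g n a
  have hmono : StrictMono s := strictMono_nat_of_lt_succ fun n => by rw [hs]; exact hg _
  have hne : {u | ∀ n, s n < u}.Nonempty := by
    obtain ⟨u, hu⟩ := hK.exists_forall_lt (ι := ULift ℕ) (by simpa using hω') fun n => s n.down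
    exact ⟨u, fun n => hu ⟨n⟩⟩
  set u := wellFounded_lt.min _ hne with hu
  have hub : ∀ n, s n < u := wellFounded_lt.min_mem _ hne
  refine ⟨u, hub 0, hQ.heightClosed_of_forall_lt fun b hb => ?_⟩
  obtain ⟨n, hn⟩ : ∃ n, b ≤ s n := by
    by_contra! h
    exact wellFounded_lt.not_lt_min {u | ∀ n, s n < u} h hb
  refine ⟨s (n + 1), hn.trans_lt (hmono n.lt_succ_self), (hub _).le, fun β hβ d' hd' => ?_⟩
  exact (hg' _ β hβ d' hd').trans ((hs (n + 1)).symm ▸ hub (n + 2))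

/-- A finite set of elements of `L` has, on arbitrarily high nonempty intervals of `K`, small
heights at the largest closed levels below. -/
theorem IsTreeSystem.exists_interval [WellFoundedLT K] (hK : IsRegularWellOrder K)
    (hQ : IsTreeSystem Q) (hht : #K = ℵ₀ → ∀ d η, ht d η ≤ d) (p : Finset L) (x₀ : K) :
    ∃ x b, x₀ ≤ x ∧ x < b ∧ (∀ m ∈ p, (∀ η ∈ p, m ≤ η) → b ∈ heightClosed Q ht m) ∧
      ∀ y, x ≤ y → y < b → ∀ η ∈ p,
        ∃ d, IsGreatest (heightClosed Q ht η ∩ Iic y) d ∧ ht d η ≤ y := by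
  induction p using Finset.induction_on_min generalizing x₀ with
  | empty =>
    obtain ⟨b, hb⟩ := hK.exists_gt x₀
    exact ⟨x₀, b, le_rfl, hb, by simp, by simp⟩
  | insert m p hm ih =>
    obtain ⟨x₁, hx₁⟩ := hK.exists_forall_mem_finset p
      (p := fun η y => m ∈ Q η y) fun η hη => hQ.eventually (hm η hη)
    obtain ⟨x, b, hx, hxb, hb, h⟩ := ih (max x₀ x₁)
    simp only [max_le_iff] at hx
    obtain ⟨a, ha⟩ := hQ.exists_isGreatest (ht := ht) m x
    -- the next closed level of `m` after `x`
    have hne : (heightClosed Q ht m ∩ Ioi x).Nonempty := by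
      obtain ⟨d, hd, hd'⟩ := hQ.exists_heightClosed_gt hK hht m x
      exact ⟨d, hd', hd⟩
    set b' := wellFounded_lt.min _ hne with hb'
    have hb'mem : b' ∈ heightClosed Q ht m ∩ Ioi x := wellFounded_lt.min_mem _ hne
    have hb'min : ∀ c ∈ heightClosed Q ht m, x < c → b' ≤ c := fun c hc hxc =>
      le_of_not_gt fun hlt => wellFounded_lt.not_lt_min
        (heightClosed Q ht m ∩ Ioi x) ⟨hc, hxc⟩ hlt
    have hab' : a < b' := (ha.1.2 : a ≤ x).trans_lt hb'mem.2
    have hhab : ht a m < b' := hb'mem.1 m (.inl rfl) a hab'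
    -- The old bound `b` is closed for the least element of `p`, hence for `m` below it; so `b' ≤ b`
    -- and the new interval stays inside the old one.
    have hbb' : ∀ y, y < b' → y < b ∨ p = ∅ := by
      intro y hy
      rcases p.eq_empty_or_nonempty with hp | hp
      · exact .inr hp
      · left
        have hmin := p.min'_mem hp
        have h1 := hb _ hmin fun η hη => p.min'_le η hη
        have h2 : m ∈ Q (p.min' hp) b := hx₁ b (hx.2.trans hxb.le) _ hmin
        exact hy.trans_le (hb'min b (hQ.heightClosed_of_mem h1 h2) hxb)
    -- On this interval the greatest closed level of `m` stays `a`, and starting at `ht a m` makes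
    -- its height fit.
    refine ⟨max x (ht a m), b', hx.1.trans (le_max_left _ _), max_lt hb'mem.2 hhab, ?_, ?_⟩
    · intro m' hm' hmin
      have : m' = m := by
        rcases Finset.mem_insert.1 hm' with h | h
        · exact h
        · exact absurd (hmin m (Finset.mem_insert_self _ _)) (hm m' h).not_ge
      rw [this]
      exact hb'mem.1
    · intro y hy hyb η hη
      rw [max_le_iff] at hy
      rcases Finset.mem_insert.1 hη with rfl | hη
      · refine ⟨a, ⟨⟨ha.1.1, (ha.1.2 : a ≤ x).trans hy.1⟩, fun c hc => ?_⟩, hy.2⟩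
        rcases le_or_gt c x with hcx | hcx
        · exact ha.2 ⟨hc.1, hcx⟩
        · exact absurd (hb'min c hc.1 hcx) ((hc.2 : c ≤ y).trans_lt hyb).not_ge
      · rcases hbb' y hyb with h' | h'
        · exact h y hy.1 h' η hη
        · simp [h'] at hη

/-- To each `x : K` one can attach partial types of elements of `L`, bounded by `x`, and sets of
predecessors of elements of `L` such that each `β < η` is eventually a predecessor of `η`, but the
types of any finite set of elements are simultaneously defined, and different from the types of all
other predecessors, for arbitrarily large `x`. -/
theorem exists_typing [WellFoundedLT K] [WellFoundedLT L] (hK : IsRegularWellOrder K)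
    (hL : ∀ η : L, #(Iio η) ≤ #K) :
    ∃ (D : K → Set L) (τ : K → L → K × K) (P : K → L → Set L),
      (∀ x η, ∀ β ∈ P x η, β < η) ∧
      (∀ x, ∀ η ∈ D x, (τ x η).1 ≤ x ∧ (τ x η).2 ≤ x) ∧
      (∀ β η, β < η → ∃ x, ∀ y, x ≤ y → η ∈ D y → β ∈ P y η) ∧
      ∀ (p : Finset L) (x₀ : K), ∃ x, x₀ ≤ x ∧ (∀ η ∈ p, η ∈ D x) ∧
        ∀ η ∈ p, ∀ η' ∈ p, ∀ β ∈ P x η, β ∈ D x → τ x β = τ x η' → β = η' := by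
  classical
  obtain ⟨Q, hQ⟩ := exists_isTreeSystem hK hL
  obtain ⟨ht, hne, hht⟩ := hQ.exists_height hK
  let E := heightClosed Q ht
  have hδ : ∃ δ : K → L → K, ∀ x η, (∃ d, IsGreatest (E η ∩ Iic x) d) →
      IsGreatest (E η ∩ Iic x) (δ x η) := by
    refine ⟨fun x η => if h : ∃ d, IsGreatest (E η ∩ Iic x) d then h.choose else x, ?_⟩
    intro x η h
    simp only [h, dite_true]
    exact h.choose_spec
  obtain ⟨δ, hδ⟩ := hδ
  refine ⟨fun x => {η | IsGreatest (E η ∩ Iic x) (δ x η) ∧ ht (δ x η) η ≤ x},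
    fun x η => (δ x η, ht (δ x η) η), fun x η => Q η (δ x η), fun x η β h => hQ.lt h,
    fun x η h => ⟨h.1.1.2, h.2⟩, fun β η hβ => ?_, fun p x₀ => ?_⟩
  · obtain ⟨x, hx⟩ := hQ.eventually hβ
    obtain ⟨d, hd, hdE⟩ := hQ.exists_heightClosed_gt hK hht η x
    exact ⟨d, fun y hy h => hx _ (hd.le.trans (h.1.2 ⟨hdE, hy⟩))⟩
  · -- beyond `x₂`, the set `p` is a chain in all trees considered
    obtain ⟨x₁, hx₁⟩ := hK.exists_forall_mem_finset (p ×ˢ p)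
      (p := fun q y => q.1 < q.2 → q.1 ∈ Q q.2 y) (by
        rintro ⟨a, b⟩ -
        by_cases hab : a < b
        · obtain ⟨x, hx⟩ := hQ.eventually hab
          exact ⟨x, fun y hy _ => hx y hy⟩
        · exact ⟨x₀, fun _ _ h => absurd h hab⟩)
    obtain ⟨x₂, hx₂⟩ := hK.exists_forall_mem_finset p
      (p := fun η y => ∃ d, x₁ ≤ d ∧ d ≤ y ∧ d ∈ E η) (by
        intro η _
        obtain ⟨d, hd, hdE⟩ := hQ.exists_heightClosed_gt hK hht η x₁
        exact ⟨d, fun y hy => ⟨d, hd.le, hy, hdE⟩⟩)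
    obtain ⟨x, b, hx, hxb, -, h⟩ := hQ.exists_interval hK hht p (max x₀ x₂)
    rw [max_le_iff] at hx
    have hD : ∀ η ∈ p, IsGreatest (E η ∩ Iic x) (δ x η) ∧ ht (δ x η) η ≤ x := by
      intro η hη
      obtain ⟨d, hd, hdx⟩ := h x le_rfl hxb η hη
      have h1 := hδ x η ⟨d, hd⟩
      exact ⟨h1, (h1.unique hd).symm ▸ hdx⟩
    have hchain : ∀ η ∈ p, ∀ η' ∈ p, η < η' → η ∈ Q η' (δ x η') := by
      intro η hη η' hη' hlt
      obtain ⟨d, hd, hdx, hdE⟩ := hx₂ x hx.2 η' hη'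
      exact hx₁ _ (hd.trans ((hD η' hη').1.2 ⟨hdE, hdx⟩)) (η, η') (by simp [hη, hη']) hlt
    refine ⟨x, hx.1, hD, fun η hη η' hη' β hβ hβD heq => ?_⟩
    simp only [Prod.mk.injEq] at heq
    obtain ⟨h1, h2⟩ := heq
    -- A level closed for `η` is closed for its predecessor `β`, so `δ x η` is at most `δ x β`.
    have hle : δ x η ≤ δ x η' := by
      rw [← h1]
      exact hβD.1.2 ⟨hQ.heightClosed_of_mem (hD η hη).1.1.1 hβ, (hD η hη).1.1.2⟩
    rw [h1] at h2
    -- In either case `β` and `η'` are equal or comparable in the tree at level `δ x η'`, where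
    -- comparable elements have different heights.
    rcases lt_or_ge η' η with hlt | hge
    · have h3 := hchain η' hη' η hη hlt
      rcases lt_trichotomy β η' with h4 | h4 | h4
      · exact absurd h2 (hne _ _ _ (hQ.mono hle (hQ.linear hβ h3 h4)))
      · exact h4
      · exact absurd h2.symm (hne _ _ _ (hQ.mono hle (hQ.linear h3 hβ h4)))
    · have h3 : β ∈ Q η' (δ x η') := by
        rcases hge.eq_or_lt with rfl | hlt
        · exact hβ
        · exact hQ.trans (hQ.mono hle hβ) (hchain η hη η' hη' hlt)
      exact absurd h2 (hne _ _ _ h3)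

end Typing

/-! ### The independent matrix -/

section Matrix

/-- A level `x : K` with finite data below `x`: a finite set that separates subsets of `K`, and
finitely many types and values for each trace on that finite set. -/
abbrev LevelPoint (K : Type u) [LinearOrder K] : Type u :=
  Σ x : K, Finset (Iic x) × Finset (Finset (Iic x) × (Iic x × Iic x)) ×
    Finset (Finset (Iic x) × Iic x)

variable {K L : Type u} [LinearOrder K]

theorem IsRegularWellOrder.mk_levelPoint_fiber (hK : IsRegularWellOrder K) (x : K) :
    #(Finset (Iic x) × Finset (Finset (Iic x) × (Iic x × Iic x)) ×
      Finset (Finset (Iic x) × Iic x)) < #K := by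
  have h := hK.small_Iic x
  have h' := hK.small_finset h
  exact hK.small_prod h' (hK.small_prod
    (hK.small_finset (hK.small_prod h' (hK.small_prod h h)))
    (hK.small_finset (hK.small_prod h' h)))

theorem IsRegularWellOrder.mk_levelPoint (hK : IsRegularWellOrder K) : #(LevelPoint K) = #K := by
  apply le_antisymm
  · rw [Cardinal.mk_sigma]
    refine (Cardinal.sum_le_sum _ (fun _ => #K) fun x => (hK.mk_levelPoint_fiber x).le).trans ?_
    rw [Cardinal.sum_const', Cardinal.mul_eq_self hK.regular.aleph0_le]
  · exact Cardinal.mk_le_of_injective (f := fun x => (⟨x, ∅, ∅, ∅⟩ : LevelPoint K))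
      fun x y h => congrArg Sigma.fst h

theorem IsRegularWellOrder.mk_level_lt (hK : IsRegularWellOrder K) (x : K) :
    #{y : LevelPoint K | y.1 < x} < #K := by
  have : {y : LevelPoint K | y.1 < x} ⊆
      ⋃ z : Iio x, range (Sigma.mk z.1 : _ → LevelPoint K) := by
    rintro ⟨z, y⟩ h
    exact mem_iUnion.2 ⟨⟨z, h⟩, y, rfl⟩
  refine (Cardinal.mk_le_mk_of_subset this).trans_lt
    ((Cardinal.card_iUnion_lt_iff_forall_of_isRegular hK.regular (hK.small x)).2 fun z => ?_)
  exact Cardinal.mk_range_le.trans_lt (hK.mk_levelPoint_fiber z.1)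

theorem IsRegularWellOrder.le_mk_of_forall_level (hK : IsRegularWellOrder K)
    {S : Set (LevelPoint K)} (h : ∀ x, ∃ y ∈ S, x ≤ y.1) : #K ≤ #S := by
  by_contra! hS
  obtain ⟨x, hx⟩ := hK.exists_forall_lt hS fun y => y.1.1
  obtain ⟨y, hy, hxy⟩ := h x
  exact (hx ⟨y, hy⟩).not_ge hxy

/-- Finitely many distinct subsets have distinct traces on some finite set. -/
theorem exists_finset_separating {α : Type*} (s : Finset (Set α)) :
    ∃ D : Finset α, ∀ i ∈ s, ∀ j ∈ s, (∀ d ∈ D, d ∈ i ↔ d ∈ j) → i = j := by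
  classical
  have h : ∀ q : Set α × Set α, ∃ D : Finset α, (∀ d ∈ D, d ∈ q.1 ↔ d ∈ q.2) → q.1 = q.2 := by
    intro q
    by_cases hq : q.1 = q.2
    · exact ⟨∅, fun _ => hq⟩
    · obtain ⟨d, hd⟩ : ∃ d, ¬ (d ∈ q.1 ↔ d ∈ q.2) := by
        by_contra! h
        exact hq (Set.ext h)
      exact ⟨{d}, fun h => absurd (h d (Finset.mem_singleton_self d)) hd⟩
  choose D hD using h
  refine ⟨(s ×ˢ s).biUnion D, fun i hi j hj h => hD (i, j) fun d hd => h d ?_⟩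
  exact Finset.mem_biUnion.2 ⟨(i, j), by simp [hi, hj], hd⟩

open Classical in
/-- The trace of `i` on the separating set of `y`. -/
noncomputable def LevelPoint.trace (y : LevelPoint K) (i : Set K) : Finset (Iic y.1) :=
  y.2.1.filter fun d => d.1 ∈ i

/-- The types that `y` assigns to `i`. -/
def LevelPoint.types (y : LevelPoint K) (i : Set K) : Set (K × K) :=
  {q | ∃ a b : Iic y.1, (y.trace i, (a, b)) ∈ y.2.2.1 ∧ q = (a.1, b.1)}

open Classical in
/-- The finite set that `y` assigns to `i`. -/
noncomputable def LevelPoint.value (y : LevelPoint K) (i : Set K) : Finset K :=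
  (y.2.2.2.filter fun q => q.1 = y.trace i).image fun q => q.2.1

/-- Points that assign prescribed types and finite sets to finitely many subsets. -/
theorem exists_levelPoint (hK : IsRegularWellOrder K) (s : Finset (Set K))
    (r : Set K → Finset K) : ∃ x₀ : K, ∀ x, x₀ ≤ x → ∀ T : Set K → Finset (K × K),
      (∀ i ∈ s, ∀ q ∈ T i, q.1 ≤ x ∧ q.2 ≤ x) →
      ∃ y : LevelPoint K, y.1 = x ∧ ∀ i ∈ s, y.types i = T i ∧ y.value i = r i := by
  classical
  obtain ⟨D, hD⟩ := exists_finset_separating s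
  have hle : ∀ a : K, ∃ x, ∀ y, x ≤ y → a ≤ y := fun a => ⟨a, fun _ h => h⟩
  obtain ⟨x₁, hx₁⟩ := hK.exists_forall_mem_finset D (p := fun a y => a ≤ y) fun a _ => hle a
  obtain ⟨x₂, hx₂⟩ := hK.exists_forall_mem_finset (s.biUnion r) (p := fun a y => a ≤ y)
    fun a _ => hle a
  refine ⟨max x₁ x₂, fun x hx T hT => ?_⟩
  rw [max_le_iff] at hx
  let c : K → Iic x := fun k => ⟨min k x, min_le_right _ _⟩
  have hc : ∀ k, k ≤ x → (c k).1 = k := fun k hk => min_eq_left hk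
  let u : Set K → Finset (Iic x) := fun i => (D.image c).filter fun d => d.1 ∈ i
  have hu : ∀ i ∈ s, ∀ j ∈ s, u i = u j → i = j := by
    intro i hi j hj hij
    refine hD i hi j hj fun d hd => ?_
    have := Finset.ext_iff.1 hij (c d)
    simp only [u, Finset.mem_filter, Finset.mem_image_of_mem c hd, true_and,
      hc d (hx₁ x hx.1 d hd)] at this
    exact this
  let y : LevelPoint K := ⟨x, D.image c,
    s.biUnion fun i => (T i).image fun q => (u i, (c q.1, c q.2)),
    s.biUnion fun i => (r i).image fun k => (u i, c k)⟩
  have hy : ∀ i, y.trace i = u i := fun i => rfl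
  refine ⟨y, rfl, fun i hi => ⟨?_, ?_⟩⟩
  · ext q
    simp only [LevelPoint.types, hy, mem_ofPred_eq, Finset.mem_coe]
    constructor
    · rintro ⟨a, b, hab, rfl⟩
      obtain ⟨j, hj, hab⟩ := Finset.mem_biUnion.1 hab
      obtain ⟨q, hq, hab⟩ := Finset.mem_image.1 hab
      simp only [Prod.mk.injEq] at hab
      obtain ⟨h1, rfl, rfl⟩ := hab
      obtain rfl := hu j hj i hi h1
      rw [hc _ (hT j hj q hq).1, hc _ (hT j hj q hq).2]
      exact hq
    · intro hq
      refine ⟨c q.1, c q.2, Finset.mem_biUnion.2 ⟨i, hi, Finset.mem_image.2 ⟨q, hq, rfl⟩⟩, ?_⟩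
      rw [hc _ (hT i hi q hq).1, hc _ (hT i hi q hq).2]
  · ext k
    simp only [LevelPoint.value, hy, Finset.mem_image, Finset.mem_filter]
    constructor
    · rintro ⟨q, ⟨hq, hqu⟩, rfl⟩
      obtain ⟨j, hj, hq⟩ := Finset.mem_biUnion.1 hq
      obtain ⟨k, hk, rfl⟩ := Finset.mem_image.1 hq
      obtain rfl := hu j hj i hi hqu
      rw [hc _ (hx₂ x hx.2 k (Finset.mem_biUnion.2 ⟨j, hj, hk⟩))]
      exact hk
    · intro hk
      exact ⟨(u i, c k), ⟨Finset.mem_biUnion.2 ⟨i, hi, Finset.mem_image.2 ⟨k, hk, rfl⟩⟩, rfl⟩,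
        hc _ (hx₂ x hx.2 k (Finset.mem_biUnion.2 ⟨i, hi, hk⟩))⟩

/-- A matrix of subsets of `α`, with rows indexed by `L` and, for each index `i`, a labelling of
`α` by finite sets such that finite intersections in `A i` are, up to small sets, labelled by
supersets of the values of `φ`, while the sets where these labels are equal to the values of `φ`
are independent for different indices. -/
structure IsShrinkingMatrix {K L ι α : Type u} (φ : Finset L → Finset K) (A : ι → L → Set α)
    (ρ : ι → α → Finset K) : Prop where
  mk_lt : ∀ i (p : Finset L), p.Nonempty →
    #{y | (∀ η ∈ p, y ∈ A i η) ∧ ¬ φ p ⊆ ρ i y} < #K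
  le_mk : ∀ (s : Finset ι) (p : ι → Finset L),
    #K ≤ #{y | ∀ i ∈ s, (∀ η ∈ p i, y ∈ A i η) ∧ ρ i y = φ (p i)}

variable [LinearOrder L] [WellFoundedLT K] [WellFoundedLT L]

/-- A point admits `η`, by recursion along `L`, if the type of `η` is listed and no finite set of
admitted predecessors in `P x η` violates the label. At high levels the maximum of `p` sees the rest
of `p`, so the label contains `φ p`. Conversely, listing exactly the types of `p` with label `φ p`
lets only members of `p` interfere, and monotonicity of `φ` admits them all. -/
theorem exists_isShrinkingMatrix_levelPoint (hK : IsRegularWellOrder K)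
    (hL : ∀ η : L, #(Iio η) ≤ #K) {φ : Finset L → Finset K} (hφ : IsShrinkingFunction φ) :
    ∃ (A : Set K → L → Set (LevelPoint K)) (ρ : Set K → LevelPoint K → Finset K),
      IsShrinkingMatrix φ A ρ := by
  classical
  obtain ⟨D, τ, P, hP, hτ, hev, hsep⟩ := exists_typing hK hL
  have hM : ∀ (x : K) (T : Set (K × K)) (r : Finset K), ∃ M : L → Prop, ∀ η, M η ↔
      η ∈ D x ∧ τ x η ∈ T ∧ ∀ p : Finset L,
        (∀ β ∈ p, ∃ _ : β < η, β ∈ P x η ∧ M β) → φ (insert η p) ⊆ r := by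
    intro x T r
    exact exists_forall_of_wellFounded
      (R := fun η g k => k ↔ η ∈ D x ∧ τ x η ∈ T ∧ ∀ p : Finset L,
        (∀ β ∈ p, ∃ h : β < η, β ∈ P x η ∧ g β h) → φ (insert η p) ⊆ r)
      fun η g => ⟨_, Iff.rfl⟩
  choose M hM using hM
  refine ⟨fun i η => {y | M y.1 (y.types i) (y.value i) η}, fun i y => y.value i, ?_, ?_⟩
  · intro i p hp
    obtain ⟨x, hx⟩ := hK.exists_forall_mem_finset (p.erase (p.max' hp))
      (p := fun β y => p.max' hp ∈ D y → β ∈ P y (p.max' hp)) fun β hβ => by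
        refine hev β _ (lt_of_le_of_ne (p.le_max' β (Finset.mem_of_mem_erase hβ)) ?_)
        exact Finset.ne_of_mem_erase hβ
    refine (Cardinal.mk_le_mk_of_subset ?_).trans_lt (hK.mk_level_lt x)
    rintro y ⟨h1, h2⟩
    by_contra hxy
    have hxy : x ≤ y.1 := not_lt.1 hxy
    obtain ⟨h3, -, h4⟩ := (hM _ _ _ _).1 (h1 _ (p.max'_mem hp))
    have h5 := h4 (p.erase (p.max' hp)) fun β hβ => by
      have h6 := hx _ hxy β hβ h3
      exact ⟨hP _ _ _ h6, h6, h1 β (Finset.mem_of_mem_erase hβ)⟩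
    rw [Finset.insert_erase (p.max'_mem hp)] at h5
    exact h2 h5
  · intro s p
    apply hK.le_mk_of_forall_level
    intro x₀
    obtain ⟨x₁, hx₁⟩ := exists_levelPoint hK s fun i => φ (p i)
    obtain ⟨x, hx, hxD, hxs⟩ := hsep (s.biUnion p) (max x₀ x₁)
    rw [max_le_iff] at hx
    have hmem : ∀ i ∈ s, ∀ η ∈ p i, η ∈ s.biUnion p := fun i hi η hη =>
      Finset.mem_biUnion.2 ⟨i, hi, hη⟩
    obtain ⟨y, rfl, hy⟩ := hx₁ x hx.2 (fun i => (p i).image (τ x)) (by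
      intro i hi q hq
      obtain ⟨η, hη, rfl⟩ := Finset.mem_image.1 hq
      exact hτ x η (hxD η (hmem i hi η hη)))
    refine ⟨y, fun i hi => ⟨fun η hη => ?_, (hy i hi).2⟩, hx.1⟩
    refine (hM _ _ _ _).2 ⟨hxD η (hmem i hi η hη), ?_, fun p' hp' => ?_⟩
    · rw [(hy i hi).1]
      exact Finset.mem_coe.2 (Finset.mem_image_of_mem _ hη)
    · rw [(hy i hi).2]
      refine hφ.mono _ _ (Finset.insert_subset hη fun β hβ => ?_)
      obtain ⟨-, hβP, hβM⟩ := hp' β hβ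
      obtain ⟨hβD, hβT, -⟩ := (hM _ _ _ _).1 hβM
      rw [(hy i hi).1] at hβT
      obtain ⟨η', hη', heq⟩ := Finset.mem_image.1 (Finset.mem_coe.1 hβT)
      rw [hxs η (hmem i hi η hη) η' (hmem i hi η' hη') β hβP hβD heq.symm]
      exact hη'

theorem IsShrinkingMatrix.comp_equiv {K L ι α α' : Type u} {φ : Finset L → Finset K}
    {A : ι → L → Set α} {ρ : ι → α → Finset K} (h : IsShrinkingMatrix φ A ρ) (e : α' ≃ α) :
    IsShrinkingMatrix φ (fun i η => e ⁻¹' A i η) (fun i y => ρ i (e y)) := by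
  refine ⟨fun i p hp => ?_, fun s p => ?_⟩
  · refine (Cardinal.mk_preimage_of_injective e _ e.injective).trans_lt (h.mk_lt i p hp)
  · refine (h.le_mk s p).trans (Cardinal.mk_le_of_surjective
      (f := fun y => ⟨e y.1, y.2⟩) (α := {y | ∀ i ∈ s, (∀ η ∈ p i, y ∈ e ⁻¹' A i η) ∧
        ρ i (e y) = φ (p i)}) ?_)
    rintro ⟨y, hy⟩
    exact ⟨⟨e.symm y, by simpa using hy⟩, by simp⟩

end Matrix

theorem exists_isShrinkingMatrix {K L : Type u} (hK : (#K).IsRegular)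
    (hL : #L ≤ Order.succ #K) {φ : Finset L → Finset K} (hφ : IsShrinkingFunction φ) :
    ∃ (A : Set K → L → Set K) (ρ : Set K → K → Finset K), IsShrinkingMatrix φ A ρ := by
  obtain ⟨_, _, hKo⟩ := Cardinal.exists_ord_eq_type_lt K
  obtain ⟨_, _, hLo⟩ := Cardinal.exists_ord_eq_type_lt L
  have hK' : IsRegularWellOrder K := ⟨hK, fun x => Cardinal.mk_Iio_lt x hKo⟩
  have hL' : ∀ η : L, #(Iio η) ≤ #K := fun η =>
    Order.lt_succ_iff.1 ((Cardinal.mk_Iio_lt η hLo).trans_le hL)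
  obtain ⟨A, ρ, h⟩ := exists_isShrinkingMatrix_levelPoint hK' hL' hφ
  obtain ⟨e⟩ := Cardinal.eq.1 hK'.mk_levelPoint
  exact ⟨_, _, h.comp_equiv e.symm⟩

/-! ### Extending filters along the matrix -/

section Independent

variable {K L ι : Type u}

/-- The points at which finitely many rows of a matrix have prescribed members and labels. -/
def matrixCylinder (φ : Finset L → Finset K) (A : ι → L → Set K) (ρ : ι → K → Finset K)
    (s : Finset ι) (p : ι → Finset L) : Set K :=
  {y | ∀ i ∈ s, (∀ η ∈ p i, y ∈ A i η) ∧ ρ i y = φ (p i)}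

/-- All members of the filter `F` meet all cylinders with indices outside `J`. -/
def IsIndependentMod (φ : Finset L → Finset K) (A : ι → L → Set K) (ρ : ι → K → Finset K)
    (F : Filter K) (J : Set ι) : Prop :=
  ∀ s : Finset ι, Disjoint (s : Set ι) J → ∀ p, ∀ B ∈ F,
    (B ∩ matrixCylinder φ A ρ s p).Nonempty

/-- The system `V` is shrunk, modulo small sets, by a system of members of `F`. -/
def IsShrunkBy (φ : Finset L → Finset K) (F : Filter K) (V : Finset K → Set K) : Prop :=
  ∃ W : L → Set K, (∀ η, W η ∈ F) ∧
    ∀ p : Finset L, p.Nonempty → #(((⋂ ν ∈ p, W ν) \ V (φ p) : Set K)) < #K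

variable {φ : Finset L → Finset K} {A : ι → L → Set K} {ρ : ι → K → Finset K}

/-- A filter that is independent of a matrix can be extended, using up finitely many rows, to a
filter that contains the complement of a member of a given decreasing system or shrinks it. -/
theorem IsIndependentMod.exists_step (hA : IsShrinkingMatrix φ A ρ) {F : Filter K} {J : Set ι}
    (hF : IsIndependentMod φ A ρ F J) (hJ : ∃ i, i ∉ J) {V : Finset K → Set K}
    (hV : ∀ r s : Finset K, r ⊆ s → V s ⊆ V r) :
    ∃ (F' : Filter K) (S : Finset ι), F' ≤ F ∧ IsIndependentMod φ A ρ F' (J ∪ S) ∧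
      ((∃ r, (V r)ᶜ ∈ F') ∨ IsShrunkBy φ F' V) := by
  classical
  -- If some `V r` misses a cylinder on a member of `F`, adding that cylinder expels `V r`.
  -- Otherwise all `V r` meet everything, and a fresh row can be used.
  by_cases hex : ∃ (r : Finset K) (s : Finset ι) (p : ι → Finset L), Disjoint (s : Set ι) J ∧
      ∃ B ∈ F, B ∩ V r ∩ matrixCylinder φ A ρ s p = ∅
  · obtain ⟨r, s, p, hs, B, hB, hBV⟩ := hex
    refine ⟨F ⊓ Filter.principal (matrixCylinder φ A ρ s p), s, inf_le_left, ?_, .inl ⟨r, ?_⟩⟩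
    · intro s' hs' p' B' hB'
      rw [Filter.mem_inf_principal'] at hB'
      rw [disjoint_union_right] at hs'
      obtain ⟨y, hyB, hy⟩ := hF (s ∪ s') (by simp [hs, hs'.1])
        (fun i => if i ∈ s then p i else p' i) _ hB'
      have hys : y ∈ matrixCylinder φ A ρ s p := fun i hi => by
        simpa [hi] using hy i (Finset.mem_union_left _ hi)
      refine ⟨y, hyB.resolve_left fun h => h hys, fun i hi => ?_⟩
      have his : i ∉ s := fun h => Set.disjoint_left.1 hs'.2 hi h
      simpa [his] using hy i (Finset.mem_union_right _ hi)
    · rw [Filter.mem_inf_principal']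
      filter_upwards [hB] with y hy
      by_contra! h
      simp only [mem_union, mem_compl_iff, not_or, not_not] at h
      exact (hBV ▸ ⟨⟨hy, h.2⟩, h.1⟩ : y ∈ (∅ : Set K))
  · push Not at hex
    obtain ⟨i, hi⟩ := hJ
    -- On `⋂ ν ∈ p, W ν` the label contains `φ p` up to a small set, so `V` of the label lies in `V
    -- (φ p)`. Where the label equals `φ q`, membership in `V (φ q)` suffices for `W`, which
    -- preserves independence.
    let W : L → Set K := fun η => {y | y ∈ A i η ∧ y ∈ V (ρ i y)}
    have hle : ∀ η, W η ∈ F ⊓ ⨅ η, Filter.principal (W η) := fun η =>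
      Filter.mem_inf_of_right (Filter.mem_iInf_of_mem η (Filter.mem_principal_self _))
    refine ⟨F ⊓ ⨅ η, Filter.principal (W η), {i}, inf_le_left, ?_, .inr ⟨W, hle, ?_⟩⟩
    · intro s hs p B hB
      rw [disjoint_union_right] at hs
      have his : i ∉ s := fun h => Set.disjoint_left.1 hs.2 h (by simp)
      obtain ⟨B₁, hB₁, B₂, hB₂, rfl⟩ := Filter.mem_inf_iff.1 hB
      obtain ⟨q, hq⟩ := (Filter.mem_iInf_finite _).1 hB₂
      rw [Filter.iInf_principal_finset, Filter.mem_principal] at hq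
      obtain ⟨y, ⟨hy₁, hyV⟩, hy⟩ := hex (φ q) (insert i s)
        (fun j => if j = i then q else p j)
        (by simpa [Set.disjoint_insert_left, hi] using hs.1) B₁ hB₁
      have hyi := hy i (Finset.mem_insert_self _ _)
      simp only [if_true] at hyi
      refine ⟨y, ⟨hy₁, hq (mem_iInter₂.2 fun η hη => ⟨hyi.1 η hη, ?_⟩)⟩, fun j hj => ?_⟩
      · rw [hyi.2]
        exact hyV
      · have hji : j ≠ i := fun h => his (h ▸ hj)
        simpa [hji] using hy j (Finset.mem_insert_of_mem hj)
    · intro p hp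
      refine (Cardinal.mk_le_mk_of_subset ?_).trans_lt (hA.mk_lt i p hp)
      rintro y ⟨hy, hyV⟩
      rw [mem_iInter₂] at hy
      obtain ⟨η, hη⟩ := hp
      exact ⟨fun η hη => (hy η hη).1, fun h => hyV (hV _ _ h (hy η hη).2)⟩

theorem IsShrinkingMatrix.isIndependentMod_cocardinal (hA : IsShrinkingMatrix φ A ρ)
    (hK : (#K).IsRegular) (J : Set ι) : IsIndependentMod φ A ρ (Filter.cocardinal K hK) J := by
  intro s _ p B hB
  rw [Filter.mem_cocardinal] at hB
  by_contra! h
  have h1 : matrixCylinder φ A ρ s p ⊆ Bᶜ := fun y hy hyB => (h ▸ ⟨hyB, hy⟩ : y ∈ (∅ : Set K))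
  exact ((hA.le_mk s p).trans (Cardinal.mk_le_mk_of_subset h1)).not_gt hB

end Independent

/-- There is a uniform ultrafilter in which every decreasing system of members, indexed by
`[κ]^{<ω}`, is shrunk modulo small sets. -/
theorem exists_ultrafilter_isShrunkBy {K L : Type u} (hK : (#K).IsRegular)
    (hL : #L ≤ Order.succ #K) {φ : Finset L → Finset K} (hφ : IsShrinkingFunction φ) :
    ∃ q : Ultrafilter K, (q : Filter K) ≤ Filter.cocardinal K hK ∧
      ∀ V : Finset K → Set K, (∀ r s : Finset K, r ⊆ s → V s ⊆ V r) → (∀ r, V r ∈ q) →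
        IsShrunkBy φ q V := by
  classical
  obtain ⟨A, ρ, hA⟩ := exists_isShrinkingMatrix hK hL hφ
  have : Infinite K := Cardinal.infinite_iff.2 hK.aleph0_le
  let T := (#(Set K)).ord.ToType
  -- There are `(2 ^ κ) ^ κ = 2 ^ κ` systems, as many as rows.
  obtain ⟨sys⟩ : Nonempty (T ≃ (Finset K → Set K)) := by
    rw [← Cardinal.eq, Cardinal.mk_toType, Cardinal.card_ord, ← Cardinal.power_def, Cardinal.mk_set,
      Cardinal.mk_finset_of_infinite, ← Cardinal.power_mul, Cardinal.mul_eq_self hK.aleph0_le]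
  have hℵ : ℵ₀ < #(Set K) := hK.aleph0_le.trans_lt (by rw [Cardinal.mk_set]; exact Cardinal.cantor _)
  -- `prior` is the filter and the set of used rows before a step of the construction
  let priorF : (V : T) → ((V' : T) → V' < V →
      Filter K × Finset (Set K)) → Filter K := fun V g =>
    Filter.cocardinal K hK ⊓ ⨅ V' : Iio V, (g V'.1 V'.2).1
  let priorJ : (V : T) → ((V' : T) → V' < V →
      Filter K × Finset (Set K)) → Set (Set K) := fun V g =>
    ⋃ V' : Iio V, ((g V'.1 V'.2).2 : Set (Set K))
  -- Independence is a hypothesis inside the relation so that the recursion is total; `hind`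
  -- discharges it afterwards.
  obtain ⟨f, hf⟩ := exists_forall_of_wellFounded
    (R := fun V g (k : Filter K × Finset (Set K)) => k.1 ≤ priorF V g ∧
      (IsIndependentMod φ A ρ (priorF V g) (priorJ V g) →
        IsIndependentMod φ A ρ k.1 (priorJ V g ∪ k.2) ∧
        ((∀ r s : Finset K, r ⊆ s → sys V s ⊆ sys V r) → (∃ r, (sys V r)ᶜ ∈ k.1) ∨ IsShrunkBy φ k.1 (sys V))))
    (by
      intro V g
      by_cases hind : IsIndependentMod φ A ρ (priorF V g) (priorJ V g)
      swap
      · exact ⟨(priorF V g, ∅), le_rfl, fun h => absurd h hind⟩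
      by_cases hV : ∀ r s : Finset K, r ⊆ s → sys V s ⊆ sys V r
      swap
      · exact ⟨(priorF V g, ∅), le_rfl, fun h => ⟨by simpa using h, fun h => absurd h hV⟩⟩
      -- Fewer than `2 ^ κ` earlier steps used finitely many rows each, so a fresh row remains.
      have hJ : #(priorJ V g) < #(Set K) := by
        refine (Cardinal.mk_iUnion_le _).trans_lt (Cardinal.mul_lt_of_lt hℵ.le ?_ ?_)
        · exact (Cardinal.mk_Iio_lt V (by simp [T])).trans_eq (by simp [T])
        · exact (ciSup_le' fun V' => (Cardinal.lt_aleph0_of_finite _).le).trans_lt hℵ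
      have hi : ∃ i, i ∉ priorJ V g := by
        by_contra! h
        rw [eq_univ_of_forall h, Cardinal.mk_univ] at hJ
        exact lt_irrefl _ hJ
      obtain ⟨F', S, h1, h2, h3⟩ := hind.exists_step hA hi hV
      exact ⟨(F', S), h1, fun _ => ⟨h2, fun _ => h3⟩⟩)
  have hanti : ∀ V' V, V' ≤ V → (f V).1 ≤ (f V').1 := by
    intro V' V h
    rcases h.eq_or_lt with rfl | h
    · exact le_rfl
    · exact ((hf V).1.trans inf_le_right).trans (iInf_le (fun V' : Iio V => (f V'.1).1) ⟨V', h⟩)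
  have hind : ∀ V, IsIndependentMod φ A ρ (priorF V fun V' _ => f V')
      (priorJ V fun V' _ => f V') := by
    intro V
    induction V using WellFoundedLT.induction with
    | ind V ih =>
      intro s hs p B hB
      rcases isEmpty_or_nonempty (Iio V) with hempty | hne
      · simp only [priorF, iInf_of_empty, inf_top_eq] at hB
        exact hA.isIndependentMod_cocardinal hK _ s hs p B hB
      · obtain ⟨B₁, hB₁, B₂, hB₂, rfl⟩ := Filter.mem_inf_iff.1 hB
        rw [Filter.mem_iInf_of_directed] at hB₂
        · obtain ⟨V', hV'⟩ := hB₂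
          refine ((hf V'.1).2 (ih V'.1 V'.2)).1 s ?_ p _ (Filter.inter_mem ?_ hV')
          · refine hs.mono_right ?_
            rintro i (hi | hi)
            · obtain ⟨V'', hi⟩ := mem_iUnion.1 hi
              exact mem_iUnion.2 ⟨⟨V''.1, (mem_Iio.1 V''.2).trans V'.2⟩, hi⟩
            · exact mem_iUnion.2 ⟨V', hi⟩
          · exact ((hf V'.1).1.trans inf_le_left) hB₁
        · intro a b
          rcases le_total a.1 b.1 with h | h
          · exact ⟨b, hanti _ _ h, le_rfl⟩
          · exact ⟨a, le_rfl, hanti _ _ h⟩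
  have hne : (⨅ V, (f V).1).NeBot := by
    refine Filter.iInf_neBot_of_directed ?_ fun V => ?_
    · intro a b
      rcases le_total a b with h | h
      · exact ⟨b, hanti _ _ h, le_rfl⟩
      · exact ⟨a, le_rfl, hanti _ _ h⟩
    · rw [← Filter.forall_mem_nonempty_iff_neBot]
      intro B hB
      exact (((hf V).2 (hind V)).1 ∅ (by simp) (fun _ => ∅) B hB).mono inter_subset_left
  refine ⟨Ultrafilter.of (⨅ V, (f V).1), ?_, fun V hV hVq => ?_⟩
  · exact (Ultrafilter.of_le _).trans ((iInf_le _ (sys.symm fun _ => ∅)).trans ((hf _).1.trans inf_le_left))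
  · obtain ⟨V, rfl⟩ := sys.surjective V
    have hle := (Ultrafilter.of_le (⨅ V, (f V).1)).trans (iInf_le _ V)
    rcases ((hf V).2 (hind V)).2 hV with ⟨r, hr⟩ | ⟨W, hW, h⟩
    · exact absurd (hVq r) (Ultrafilter.compl_mem_iff_notMem.1 (hle hr))
    · exact ⟨W, fun η => hle (hW η), h⟩

/-! ### The two-step tower and the closed sets -/

theorem mem_remainder_of_le_cocardinal {K : Type u} (hK : (#K).IsRegular) {q : Ultrafilter K}
    (hq : (q : Filter K) ≤ Filter.cocardinal K hK) : q ∈ remainder K := by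
  rintro ξ rfl
  have h : ({ξ}ᶜ : Set K) ∈ Filter.cocardinal K hK :=
    (Set.finite_singleton ξ).compl_mem_cocardinal
  simpa using Ultrafilter.mem_pure.1 (hq h)

theorem zero_lt_twoPow (K : Type u) : 0 < twoPow K := by
  rw [twoPow, Cardinal.ord_pos]
  exact pos_iff_ne_zero.2 (Cardinal.power_ne_zero _ two_ne_zero)

theorem one_lt_twoPow (K : Type u) [Infinite K] : 1 < twoPow K := by
  rw [twoPow, Cardinal.lt_ord, Ordinal.card_one]
  exact (Cardinal.one_lt_aleph0.trans_le (Cardinal.infinite_iff.1 ‹_›)).trans (Cardinal.cantor _)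

/-- The tower that passes from the filter of co-small sets to a uniform ultrafilter which shrinks
its own decreasing systems. -/
theorem isShrinkingTower_of_isShrunkBy {K L : Type u} (hK : (#K).IsRegular)
    {φ : Finset L → Finset K} {q : Ultrafilter K}
    (hq : (q : Filter K) ≤ Filter.cocardinal K hK)
    (hqs : ∀ V : Finset K → Set K, (∀ r s : Finset K, r ⊆ s → V s ⊆ V r) → (∀ r, V r ∈ q) →
      IsShrunkBy φ q V) :
    IsShrinkingTower hK φ (fun β => if β = 0 then Filter.cocardinal K hK else q) q where
  zero := by simp
  mono β β' hβ _ A hA := by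
    by_cases h' : β' = 0
    · obtain rfl : β = 0 := by simpa [h'] using hβ
      simpa [h'] using hA
    · by_cases h : β = 0
      · simp only [h, if_true] at hA
        simpa [h'] using hq hA
      · simpa [h, h'] using hA
  union A := by
    have : Infinite K := Cardinal.infinite_iff.2 hK.aleph0_le
    constructor
    · exact fun hA => ⟨1, one_lt_twoPow K, by simpa using hA⟩
    · rintro ⟨β, -, hA⟩
      by_cases h : β = 0
      · simp only [h, if_true] at hA
        exact hq hA
      · simpa [h] using hA
  shrink β _ V hV hVF := by
    obtain ⟨W, hW, h⟩ := hqs V hV fun r => by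
      have hr := hVF r
      by_cases h : β = 0
      · simp only [h, if_true] at hr
        exact hq hr
      · simpa [h] using hr
    exact ⟨W, fun η => by simpa using hW η, h⟩

theorem theorem2 {K L : Type u} (hK : (#K).IsRegular) (hL : #L = Order.succ #K)
    (φ : Finset L → Finset K) (hφ : IsShrinkingFunction φ)
    {X : Type v} [TopologicalSpace X] [CompactSpace X] [T2Space X]
    (f : X → Ultrafilter K) (hf : Continuous f) (hopen : IsOpenMap f)
    (hsurj : Function.Surjective f) :
    ∃ (U : Ordinal.{u} → Set X) (F : Ordinal.{u} → Filter K) (q : Ultrafilter K),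
      (∀ β < twoPow K, (U β).Nonempty ∧ IsClosed (U β)) ∧
      -- (i)
      (∀ β' β : Ordinal.{u}, β' ≤ β → β < twoPow K → U β ⊆ U β') ∧
      -- (ii)
      (∀ γ < twoPow K, f ⁻¹' remainder K ∩ stageSet f U γ = ∅ →
        ∃ ξ : K, U γ = f ⁻¹' {pure ξ} ∩ stageSet f U γ) ∧
      -- (iii), (a) and (b)
      IsShrinkingTower hK φ F q ∧
      -- (iii), (c)
      (∀ γ < twoPow K, (f ⁻¹' remainder K ∩ stageSet f U γ).Nonempty →
        ∀ A ∈ Filter.generate {A : Set K | ∃ β < γ, A ∈ F β},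
          (f ⁻¹' basicClopen A ∩ stageSet f U γ).Nonempty) ∧
      -- the points of the intersection
      (∀ x : X, (∀ β < twoPow K, x ∈ U β) →
        (∃ ξ : K, f x = pure ξ) ∨
        ∃ h : f x ∈ remainder K, IsShrinkingPoint φ (⟨f x, h⟩ : remainder K)) ∧
      -- the shrinking point is the union of the chain whenever that union is one
      (∀ h : q ∈ remainder K, IsShrinkingPoint φ (⟨q, h⟩ : remainder K) →
        ∀ x : X, (∀ β < twoPow K, x ∈ U β) → f x = q) := by
  obtain ⟨q, hq, hqs⟩ := exists_ultrafilter_isShrunkBy hK hL.le hφ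
  have hqr : q ∈ remainder K := mem_remainder_of_le_cocardinal hK hq
  have htower := isShrinkingTower_of_isShrunkBy hK hq hqs
  set F : Ordinal.{u} → Filter K := fun β => if β = 0 then Filter.cocardinal K hK else q
  obtain ⟨x₀, hx₀⟩ := hsurj q
  -- The last clause forces the fibre over `q` only when `q` is a shrinking point.
  by_cases hshr : IsShrinkingPoint φ (⟨q, hqr⟩ : remainder K)
  · have hstage : ∀ γ, x₀ ∈ stageSet f (fun _ => f ⁻¹' {q}) γ := fun γ => by
      have h1 : x₀ ∈ interBelow (fun _ : Ordinal.{u} => f ⁻¹' {q}) γ ∩ f ⁻¹' remainder K :=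
        ⟨fun _ _ => hx₀, by rwa [mem_preimage, hx₀]⟩
      rw [stageSet, if_pos ⟨x₀, h1⟩]
      exact h1
    have hmem : ∀ γ, x₀ ∈ f ⁻¹' remainder K ∩ stageSet f (fun _ => f ⁻¹' {q}) γ := fun γ =>
      ⟨by rwa [mem_preimage, hx₀], hstage γ⟩
    refine ⟨fun _ => f ⁻¹' {q}, F, q, fun β _ => ⟨⟨x₀, hx₀⟩, isClosed_singleton.preimage hf⟩,
      fun _ _ _ _ => subset_rfl, fun γ _ h => ?_, htower, fun γ hγ _ A hA => ⟨x₀, ?_, hstage γ⟩,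
      fun x hx => ?_, fun _ _ x hx => hx 0 (zero_lt_twoPow K)⟩
    · exact absurd (hmem γ) (h ▸ notMem_empty x₀)
    · rw [mem_preimage, hx₀]
      have hle : (q : Filter K) ≤ Filter.generate {A : Set K | ∃ β < γ, A ∈ F β} := by
        rw [Filter.le_generate_iff]
        rintro B ⟨β, hβ, hB⟩
        exact (htower.union B).2 ⟨β, hβ.trans hγ, hB⟩
      exact ⟨hqr, hle hA⟩
    · obtain rfl : f x = q := hx 0 (zero_lt_twoPow K)
      exact .inr ⟨hqr, hshr⟩
  · -- shrinking in `κ*` is modulo finite sets, so for `κ > ω` the space `κ*` may have no shrinking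
    -- point at all; the closed sets then have to lie over a point of `κ`
    obtain ⟨ξ⟩ : Nonempty K := Cardinal.mk_ne_zero_iff.1 hK.ne_zero
    obtain ⟨x₁, hx₁⟩ := hsurj (pure ξ)
    let U : Ordinal.{u} → Set X := fun _ => f ⁻¹' {pure ξ}
    have hU : ∀ x, x ∈ f ⁻¹' {pure ξ} → x ∉ f ⁻¹' remainder K := fun x hx h => h ξ hx
    -- `C_0 = X` meets `f ⁻¹' κ*`, so (ii) is vacuous at `0` and `U 0` may already lie over `ξ`.
    have hzero : x₀ ∈ f ⁻¹' remainder K ∩ stageSet f U 0 := by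
      have h1 : x₀ ∈ interBelow U 0 ∩ f ⁻¹' remainder K :=
        ⟨fun β hβ => absurd hβ not_lt_zero, by rwa [mem_preimage, hx₀]⟩
      rw [stageSet, if_pos ⟨x₀, h1⟩]
      exact ⟨h1.2, h1⟩
    have hpos : ∀ γ, 0 < γ → stageSet f U γ = f ⁻¹' {pure ξ} := by
      intro γ hγ
      have h1 : interBelow U γ = f ⁻¹' {pure ξ} :=
        Subset.antisymm (fun x hx => hx 0 hγ) fun x hx _ _ => hx
      rw [stageSet, h1, if_neg]
      rintro ⟨x, hx, hx'⟩
      exact hU x hx hx'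
    refine ⟨U, F, q, fun β _ => ⟨⟨x₁, hx₁⟩, isClosed_singleton.preimage hf⟩,
      fun _ _ _ _ => subset_rfl, fun γ _ h => ⟨ξ, ?_⟩, htower, fun γ hγ hne A hA => ?_,
      fun x hx => .inl ⟨ξ, hx 0 (zero_lt_twoPow K)⟩, fun _ h => absurd h hshr⟩
    · rcases eq_zero_or_pos γ with rfl | hγ
      · exact absurd hzero (h ▸ notMem_empty x₀)
      · rw [hpos γ hγ, inter_self]
    · rcases eq_zero_or_pos γ with rfl | hγ
      -- No filter precedes stage `0`, so (c) concerns only `univ` there.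
      · have hA' : A = univ := by
          have : {A : Set K | ∃ β < (0 : Ordinal.{u}), A ∈ F β} = ∅ := by
            ext B; simp
          rw [this, Filter.generate_empty] at hA
          exact Filter.mem_top.1 hA
        refine ⟨x₀, ?_, hzero.2⟩
        rw [mem_preimage, hx₀, hA']
        exact ⟨hqr, Filter.univ_mem⟩
      · obtain ⟨x, hx, hx'⟩ := hne
        rw [hpos γ hγ] at hx'
        exact absurd hx (hU x hx')
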